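/- Let $n, d \in \mathbb{N}$ and $p \in [\tfrac12, 1)$, and suppose that $d \ge 100$ and $n \ge 200\,\frac{p}{1-p}\log d$ (natural logarithm). Let $X^i_t$ ($1 \le i \le d$, $1 \le t \le n$) be independent real random variables on a probability space, each equal to $1-p$ with probability $p$ and to $-p$ with probability $1-p$, and let $Z_i^{(n)} = \sum_{t=1}^n X^i_t$ be the corresponding $d$ independent zero-mean random walks of length $n$. Then $p \le 1 - \frac1n$, the random variable $\max_{1\le i\le d} Z_i^{(n)}$ is integrable, and $$\mathbb{E}\Big[\max_{1\le i\le d} Z_i^{(n)}\Big] \;\ge\; 0.02\,\sqrt{n\,p\,(1-p)\log d}\; -\; 1.5 .$$ -/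

import Mathlib

open MeasureTheory ProbabilityTheory

/-- The law of one step of the walk: the value `1 - p` with probability `p`, and the value `-p`
with probability `1 - p`. -/
noncomputable def stepLaw (p : ℝ) : Measure ℝ :=
  ENNReal.ofReal p • Measure.dirac (1 - p) + ENNReal.ofReal (1 - p) • Measure.dirac (-p)

/-- The position after `n` steps of the walk with steps `X 0, …, X (n - 1)`. -/
def walk {Ω : Type*} {n : ℕ} (X : Fin n → Ω → ℝ) (ω : Ω) : ℝ :=
  ∑ t : Fin n, X t ω

/-! Write `L = log d`, `v = n p (1 - p)` and `t = 0.06 √(v L)`. A Paley–Zygmund argument applied to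
`exp (l Z)`, with two-sided Gaussian-type bounds on the moment generating function, shows that one
walk reaches `t` with probability at least `q = d ^ (-0.6) / 4` (`div_le_integral_indicator_walk`).
Set one walk aside. By independence the other `d - 1` all stay below `t` with probability at most
`exp (-q (d - 1)) ≤ 1 / 2`. On that event the maximum is at least the reserved walk, which is
centred and independent of the event, so it contributes nothing on average
(`mul_one_sub_exp_le_integral_iSup_walk`). The expected maximum is therefore at least `t / 2`. -/

lemma abs_exp_sub_quadratic_le {x : ℝ} (hx : |x| ≤ 1 / 8) :
    |Real.exp x - (1 + x + x ^ 2 / 2)| ≤ x ^ 2 / 36 := by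
  have h := Real.exp_bound (x := x) (by linarith) (n := 3) (by norm_num)
  simp only [Finset.sum_range_succ, Finset.sum_range_zero, Nat.factorial] at h
  norm_num at h
  refine h.trans ?_
  have h2 : |x| ^ 3 = x ^ 2 * |x| := by rw [pow_succ, sq_abs]
  rw [h2]
  nlinarith [sq_nonneg x]

lemma exp_le_quadratic {x : ℝ} (hx : |x| ≤ 1 / 8) :
    Real.exp x ≤ 1 + x + 0.53 * x ^ 2 := by
  have := (abs_le.1 (abs_exp_sub_quadratic_le hx)).2
  nlinarith [sq_nonneg x]

lemma quadratic_le_exp {x : ℝ} (hx : |x| ≤ 1 / 8) :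
    1 + x + 0.47 * x ^ 2 ≤ Real.exp x := by
  have := (abs_le.1 (abs_exp_sub_quadratic_le hx)).1
  nlinarith [sq_nonneg x]

/-- The moment generating function of one step. -/
noncomputable def stepMgf (p l : ℝ) : ℝ :=
  p * Real.exp (l * (1 - p)) + (1 - p) * Real.exp (l * (-p))

section StepMgf

variable {p l : ℝ}

lemma abs_mul_step_le (hp : 1 / 2 ≤ p) (hp1 : p < 1) (hl : |l * p| ≤ 1 / 8) :
    |l * (1 - p)| ≤ 1 / 8 ∧ |l * (-p)| ≤ 1 / 8 := by
  constructor
  · refine le_trans ?_ hl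
    rw [abs_mul, abs_mul, abs_of_pos (by linarith : 0 < 1 - p), abs_of_pos (by linarith : 0 < p)]
    exact mul_le_mul_of_nonneg_left (by linarith) (abs_nonneg l)
  · rwa [mul_neg, abs_neg]

/-- The step is centred with variance `p (1 - p)`, so the linear terms of the expansion cancel.
Since `1 - p ≤ p`, controlling `l * p` controls both exponents. -/
lemma stepMgf_le (hp : 1 / 2 ≤ p) (hp1 : p < 1) (hl : |l * p| ≤ 1 / 8) :
    stepMgf p l ≤ Real.exp (0.53 * (p * (1 - p) * l ^ 2)) := by
  obtain ⟨h1, h2⟩ := abs_mul_step_le hp hp1 hl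
  have e1 := mul_le_mul_of_nonneg_left (exp_le_quadratic h1) (by linarith : 0 ≤ p)
  have e2 := mul_le_mul_of_nonneg_left (exp_le_quadratic h2) (by linarith : 0 ≤ 1 - p)
  have e3 := Real.add_one_le_exp (0.53 * (p * (1 - p) * l ^ 2))
  unfold stepMgf
  linarith

lemma le_stepMgf (hp : 1 / 2 ≤ p) (hp1 : p < 1) (hl : |l * p| ≤ 1 / 8) :
    Real.exp (0.46 * (p * (1 - p) * l ^ 2)) ≤ stepMgf p l := by
  obtain ⟨h1, h2⟩ := abs_mul_step_le hp hp1 hl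
  have e1 := mul_le_mul_of_nonneg_left (quadratic_le_exp h1) (by linarith : 0 ≤ p)
  have e2 := mul_le_mul_of_nonneg_left (quadratic_le_exp h2) (by linarith : 0 ≤ 1 - p)
  have hu0 : 0 ≤ p * (1 - p) * l ^ 2 := by
    have : 0 ≤ 1 - p := by linarith
    positivity
  have hu1 : p * (1 - p) * l ^ 2 ≤ 1 / 64 := by
    have h3 : (l * p) ^ 2 ≤ (1 / 8) ^ 2 := sq_le_sq' (abs_le.1 hl).1 (abs_le.1 hl).2
    have h4 : (1 - p) * (p * l ^ 2) ≤ p * (p * l ^ 2) :=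
      mul_le_mul_of_nonneg_right (by linarith) (by positivity)
    -- The drop from 0.47 to 0.46 pays for turning `1 + 0.47 u` back into an exponential, for which
    -- `u ≤ 1 / 64` suffices.
    nlinarith
  have e3 := exp_le_quadratic (x := 0.46 * (p * (1 - p) * l ^ 2))
    (by rw [abs_of_nonneg (by linarith)]; linarith)
  unfold stepMgf
  nlinarith

end StepMgf

lemma walk_eq_sum {Ω : Type*} {n : ℕ} (Y : Fin n → Ω → ℝ) : walk Y = ∑ t, Y t := by
  ext ω; simp [walk]

/-! ### Moments and tail of a single walk -/

section Walk

variable {Ω : Type*} [MeasurableSpace Ω] {P : Measure Ω} {n : ℕ} {p : ℝ}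

lemma integral_stepLaw (hp : 0 ≤ p) (hp1 : p ≤ 1) (f : ℝ → ℝ) :
    ∫ x, f x ∂stepLaw p = p * f (1 - p) + (1 - p) * f (-p) := by
  have hi : ∀ a : ℝ, Integrable f (Measure.dirac a) := fun a => by
    simp [integrable_dirac]
  unfold stepLaw
  rw [integral_add_measure ((hi _).smul_measure ENNReal.ofReal_ne_top)
    ((hi _).smul_measure ENNReal.ofReal_ne_top), integral_smul_measure, integral_smul_measure]
  simp [hp, hp1]

lemma ProbabilityTheory.HasLaw.abs_le_one_of_stepLaw {Y : Ω → ℝ} (hY : HasLaw Y (stepLaw p) P)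
    (hp : 0 ≤ p) (hp1 : p ≤ 1) : ∀ᵐ ω ∂P, |Y ω| ≤ 1 := by
  have hm : MeasurableSet {x : ℝ | |x| ≤ 1} := measurableSet_le (by fun_prop) (by fun_prop)
  rw [hY.ae_iff (p := fun x => |x| ≤ 1) (measurableSet_setOfPred.1 hm)]
  have h1 : |1 - p| ≤ 1 := abs_le.2 ⟨by linarith, by linarith⟩
  have h2 : |-p| ≤ 1 := abs_le.2 ⟨by linarith, by linarith⟩
  unfold stepLaw
  rw [ae_add_measure_iff]
  constructor
  · refine Measure.ae_smul_measure ?_ _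
    rw [ae_dirac_iff hm]; exact h1
  · refine Measure.ae_smul_measure ?_ _
    rw [ae_dirac_iff hm]; exact h2

variable {Y : Fin n → Ω → ℝ}

lemma aemeasurable_walk (hY : ∀ t, AEMeasurable (Y t) P) : AEMeasurable (walk Y) P := by
  rw [walk_eq_sum]; exact Finset.aemeasurable_sum _ fun t _ => hY t

lemma ae_abs_walk_le (hY : ∀ t, HasLaw (Y t) (stepLaw p) P) (hp : 0 ≤ p) (hp1 : p ≤ 1) :
    ∀ᵐ ω ∂P, |walk Y ω| ≤ n := by
  filter_upwards [ae_all_iff.2 fun t => (hY t).abs_le_one_of_stepLaw hp hp1] with ω hω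
  calc |walk Y ω| ≤ ∑ t, |Y t ω| := Finset.abs_sum_le_sum_abs _ _
    _ ≤ ∑ _t : Fin n, (1 : ℝ) := Finset.sum_le_sum fun t _ => hω t
    _ = n := by simp

lemma integrable_walk [IsProbabilityMeasure P] (hY : ∀ t, HasLaw (Y t) (stepLaw p) P)
    (hp : 0 ≤ p) (hp1 : p ≤ 1) : Integrable (walk Y) P :=
  Integrable.of_bound (aemeasurable_walk fun t => (hY t).aemeasurable).aestronglyMeasurable n
    (ae_abs_walk_le hY hp hp1)

lemma integrable_exp_mul_walk [IsProbabilityMeasure P] (hY : ∀ t, HasLaw (Y t) (stepLaw p) P)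
    (hp : 0 ≤ p) (hp1 : p ≤ 1) (l : ℝ) : Integrable (fun ω => Real.exp (l * walk Y ω)) P := by
  have hm := aemeasurable_walk fun t => (hY t).aemeasurable
  refine Integrable.of_bound (by fun_prop) (Real.exp (|l| * n)) ?_
  filter_upwards [ae_abs_walk_le hY hp hp1] with ω hω
  rw [Real.norm_eq_abs, Real.abs_exp, Real.exp_le_exp]
  calc l * walk Y ω ≤ |l| * |walk Y ω| := by rw [← abs_mul]; exact le_abs_self _
    _ ≤ |l| * n := mul_le_mul_of_nonneg_left hω (abs_nonneg l)

lemma integral_walk (hY : ∀ t, HasLaw (Y t) (stepLaw p) P) [IsProbabilityMeasure P]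
    (hp : 0 ≤ p) (hp1 : p ≤ 1) : ∫ ω, walk Y ω ∂P = 0 := by
  unfold walk
  rw [integral_finsetSum]
  · refine Finset.sum_eq_zero fun t _ => ?_
    rw [(hY t).integral_eq, integral_stepLaw hp hp1]
    ring
  · intro t _
    exact Integrable.of_bound (hY t).aemeasurable.aestronglyMeasurable 1
      ((hY t).abs_le_one_of_stepLaw hp hp1)

lemma integral_exp_mul_walk (hY : ∀ t, HasLaw (Y t) (stepLaw p) P) (hind : iIndepFun Y P)
    (hp : 0 ≤ p) (hp1 : p ≤ 1) (l : ℝ) :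
    ∫ ω, Real.exp (l * walk Y ω) ∂P = stepMgf p l ^ n := by
  have h := hind.mgf_sum₀ (t := l) (fun t => (hY t).aemeasurable) Finset.univ
  rw [← walk_eq_sum] at h
  have hstep : ∀ t, mgf (Y t) P l = stepMgf p l := fun t => by
    have h1 := (hY t).integral_comp (f := fun x => Real.exp (l * x)) (by fun_prop)
    rw [integral_stepLaw hp hp1] at h1
    exact h1
  rw [Finset.prod_congr rfl fun t _ => hstep t] at h
  simpa [mgf] using h

/-- A Paley–Zygmund bound for the exponential moments of a random variable. -/
lemma sq_div_le_integral_indicator_Ici [IsProbabilityMeasure P] {Z : Ω → ℝ}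
    (hZ : AEMeasurable Z P) {l t m M : ℝ} (hl : 0 ≤ l) (hm : 0 < m) (hM : 0 < M)
    (h1i : Integrable (fun ω => Real.exp (l * Z ω)) P)
    (h2i : Integrable (fun ω => Real.exp (2 * l * Z ω)) P)
    (h1 : m ≤ ∫ ω, Real.exp (l * Z ω) ∂P) (h2 : ∫ ω, Real.exp (2 * l * Z ω) ∂P ≤ M)
    (ht : Real.exp (l * t) ≤ m / 2) :
    m ^ 2 / (4 * M) ≤ ∫ ω, (Set.Ici t).indicator 1 (Z ω) ∂P := by
  set g : Ω → ℝ := fun ω => (Set.Ici t).indicator 1 (Z ω) with hg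
  have hgi : Integrable g P := by
    refine Integrable.of_bound (C := 1) ?_ (ae_of_all _ fun ω => ?_)
    · exact ((measurable_one.indicator measurableSet_Ici).comp_aemeasurable hZ).aestronglyMeasurable
    · by_cases h : Z ω ∈ Set.Ici t <;> simp [hg, h]
  -- On `Z ≥ t` this is AM-GM, `y ≤ a y ^ 2 + 1 / (4 a)` with `a = m / (4 M)`; off it, the term `m /
  -- 2` is enough. Upon integration the first two terms cost at most `3 m / 4`.
  have key : ∀ ω, Real.exp (l * Z ω) ≤
      m / 2 + m / (4 * M) * Real.exp (2 * l * Z ω) + M / m * g ω := by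
    intro ω
    have hsq : Real.exp (2 * l * Z ω) = Real.exp (l * Z ω) ^ 2 := by
      rw [← Real.exp_nat_mul]; congr 1; push_cast; ring
    rw [hsq]
    by_cases h : t ≤ Z ω
    · have : g ω = 1 := by simp [hg, h]
      rw [this]
      have h3 : 0 ≤ m / (4 * M) * (Real.exp (l * Z ω) - 2 * M / m) ^ 2 := by positivity
      have h4 : m / (4 * M) * (Real.exp (l * Z ω) - 2 * M / m) ^ 2 =
          m / (4 * M) * Real.exp (l * Z ω) ^ 2 + M / m * 1 - Real.exp (l * Z ω) := by
        field_simp; ring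
      linarith
    · have : g ω = 0 := by simp [hg, h]
      rw [this]
      have h3 : Real.exp (l * Z ω) ≤ Real.exp (l * t) :=
        Real.exp_le_exp.2 (mul_le_mul_of_nonneg_left (by linarith) hl)
      have h4 : 0 ≤ m / (4 * M) * Real.exp (l * Z ω) ^ 2 := by positivity
      linarith
  have hsum : Integrable (fun ω => m / 2 + m / (4 * M) * Real.exp (2 * l * Z ω)) P :=
    (integrable_const (m / 2)).add (h2i.const_mul (m / (4 * M)))
  have hint := integral_mono h1i (hsum.add (hgi.const_mul (M / m))) key
  simp only [Pi.add_apply] at hint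
  rw [integral_add hsum (hgi.const_mul (M / m)), integral_add (integrable_const _) (h2i.const_mul (m / (4 * M))),
    integral_const_mul, integral_const_mul] at hint
  simp only [integral_const, probReal_univ, smul_eq_mul, one_mul] at hint
  have h5 : m / (4 * M) * ∫ ω, Real.exp (2 * l * Z ω) ∂P ≤ m / (4 * M) * M :=
    mul_le_mul_of_nonneg_left h2 (by positivity)
  have h6 : m / (4 * M) * M = m / 4 := by field_simp
  have h7 : m / 4 ≤ M / m * ∫ ω, g ω ∂P := by linarith
  calc m ^ 2 / (4 * M) = m / M * (m / 4) := by field_simp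
    _ ≤ m / M * (M / m * ∫ ω, g ω ∂P) := mul_le_mul_of_nonneg_left h7 (by positivity)
    _ = ∫ ω, g ω ∂P := by field_simp

lemma div_le_integral_indicator_walk [IsProbabilityMeasure P]
    (hY : ∀ t, HasLaw (Y t) (stepLaw p) P) (hind : iIndepFun Y P)
    (hp : 1 / 2 ≤ p) (hp1 : p < 1) {L : ℝ} (hL : 4.5 ≤ L)
    (hn : 200 * (p / (1 - p)) * L ≤ n) :
    Real.exp (-0.6 * L) / 4 ≤
      ∫ ω, (Set.Ici (0.06 * √(n * p * (1 - p) * L))).indicator 1 (walk Y ω) ∂P := by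
  have hq : 0 < 1 - p := by linarith
  have hp0 : 0 < p := by linarith
  have hL0 : 0 < L := by linarith
  have hn0 : (0 : ℝ) < n := lt_of_lt_of_le (by positivity) hn
  have hn' : 200 * p * L ≤ n * (1 - p) := by
    have := mul_le_mul_of_nonneg_right hn hq.le
    have e : 200 * (p / (1 - p)) * L * (1 - p) = 200 * p * L := by field_simp
    linarith
  set v : ℝ := n * p * (1 - p) with hv
  have hv0 : 0 < v := by positivity
  -- Now `l ^ 2 v = 0.49 L`, so the exponents below are `0.46 * 0.49 = 0.2254` and `0.53 * 4 * 0.49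
  -- = 1.0388`, and `2 * 0.2254 - 1.0388 ≥ -0.6`.
  set l : ℝ := 0.7 * √(L / v) with hl
  have hl0 : 0 ≤ l := by positivity
  have hl2 : l ^ 2 = 0.49 * (L / v) := by
    rw [hl, mul_pow, Real.sq_sqrt (by positivity)]; norm_num
  have hlv : n * (p * (1 - p) * l ^ 2) = 0.49 * L := by
    rw [hl2, hv]; field_simp
  -- The bound is 1/16 rather than 1/8 because the second moment uses `2 * l`. The lower bound on
  -- `n` gives `(l p) ^ 2 ≤ 0.49 / 200`.
  have hlp : l * p ≤ 1 / 16 := by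
    refine abs_le_of_sq_le_sq' ?_ (by norm_num) |>.2
    have e : (l * p) ^ 2 * (n * (1 - p)) = 0.49 * L * p := by
      rw [← hlv]; ring
    have h3 : 0 ≤ (l * p) ^ 2 := sq_nonneg _
    have h4 : (l * p) ^ 2 * (200 * p * L) ≤ 0.49 / 200 * (200 * p * L) := by
      calc _ ≤ (l * p) ^ 2 * (n * (1 - p)) := mul_le_mul_of_nonneg_left hn' h3
        _ = _ := by rw [e]; ring
    have h5 := le_of_mul_le_mul_right h4 (by positivity)
    norm_num at h5 ⊢; linarith
  have hlp0 : 0 ≤ l * p := by positivity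
  have hlt : l * (0.06 * √(v * L)) = 0.042 * L := by
    have : √(L / v) * √(v * L) = L := by
      rw [← Real.sqrt_mul (by positivity), show L / v * (v * L) = L ^ 2 by field_simp,
        Real.sqrt_sq hL0.le]
    rw [hl]; linear_combination 0.042 * this
  have hm : Real.exp (0.2254 * L) ≤ ∫ ω, Real.exp (l * walk Y ω) ∂P := by
    rw [integral_exp_mul_walk hY hind hp0.le hp1.le]
    calc Real.exp (0.2254 * L) = Real.exp (0.46 * (p * (1 - p) * l ^ 2)) ^ n := by
          rw [← Real.exp_nat_mul]; congr 1; linear_combination -0.46 * hlv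
      _ ≤ _ := pow_le_pow_left₀ (Real.exp_pos _).le
          (le_stepMgf hp hp1 (by rw [abs_of_nonneg hlp0]; linarith)) n
  have hM : ∫ ω, Real.exp (2 * l * walk Y ω) ∂P ≤ Real.exp (1.0388 * L) := by
    rw [integral_exp_mul_walk hY hind hp0.le hp1.le]
    have h0 : 0 ≤ stepMgf p (2 * l) := by unfold stepMgf; positivity
    calc _ ≤ Real.exp (0.53 * (p * (1 - p) * (2 * l) ^ 2)) ^ n := pow_le_pow_left₀ h0
          (stepMgf_le hp hp1 (by rw [abs_of_nonneg (by positivity)]; linarith)) n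
      _ = _ := by
          rw [← Real.exp_nat_mul]; congr 1; linear_combination 2.12 * hlv
  have ht : Real.exp (l * (0.06 * √(v * L))) ≤ Real.exp (0.2254 * L) / 2 := by
    have h1 : Real.exp (0.2254 * L) = Real.exp (0.042 * L) * Real.exp (0.1834 * L) := by
      rw [← Real.exp_add]; congr 1; ring
    have h2 := Real.quadratic_le_exp_of_nonneg (x := 0.1834 * L) (by positivity)
    have h3 : 2 ≤ Real.exp (0.1834 * L) := by nlinarith
    rw [hlt, h1]
    nlinarith [Real.exp_pos (0.042 * L)]
  refine le_trans ?_ (sq_div_le_integral_indicator_Ici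
    (aemeasurable_walk fun t => (hY t).aemeasurable) hl0 (Real.exp_pos _) (Real.exp_pos _)
    (integrable_exp_mul_walk hY hp0.le hp1.le _) (integrable_exp_mul_walk hY hp0.le hp1.le _)
    hm hM ht)
  rw [mul_comm (4 : ℝ), ← div_div, ← Real.exp_nat_mul, ← Real.exp_sub]
  refine div_le_div_of_nonneg_right (Real.exp_le_exp.2 ?_) (by norm_num)
  push_cast
  linarith

end Walk

/-! ### Independent walks and their maximum -/

section Family

variable {Ω : Type*} [MeasurableSpace Ω] {P : Measure Ω} {n d : ℕ} {X : Fin d → Fin n → Ω → ℝ}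

lemma iIndepFun_row (hindep : iIndepFun (fun it : Fin d × Fin n => X it.1 it.2) P) (i : Fin d) :
    iIndepFun (X i) P :=
  hindep.precomp (g := fun t => (i, t)) (Prod.mk_right_injective i)

/-- The two sides depend on disjoint blocks of steps. -/
lemma indepFun_walk_of_notMem (hX : ∀ i t, AEMeasurable (X i t) P)
    (hindep : iIndepFun (fun it : Fin d × Fin n => X it.1 it.2) P)
    {I : Finset (Fin d)} {i : Fin d} (hi : i ∉ I) :
    IndepFun (walk (X i)) (fun ω (j : I) => walk (X j) ω) P := by
  have hdisj : Disjoint (({i} : Finset (Fin d)) ×ˢ (Finset.univ : Finset (Fin n)))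
      (I ×ˢ (Finset.univ : Finset (Fin n))) := by
    rw [Finset.disjoint_product]
    exact Or.inl (Finset.disjoint_singleton_left.2 hi)
  have h := hindep.indepFun_finset₀ _ _ hdisj fun it => hX it.1 it.2
  refine h.comp (φ := fun x => ∑ t, x ⟨(i, t), by simp⟩)
    (ψ := fun x (j : I) => ∑ t, x ⟨(j, t), by simp⟩) ?_ ?_
  · fun_prop
  · fun_prop

lemma aemeasurable_walks (hX : ∀ i t, AEMeasurable (X i t) P) (I : Finset (Fin d)) :
    AEMeasurable (fun ω (j : I) => walk (X j) ω) P :=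
  aemeasurable_pi_lambda _ fun j => aemeasurable_walk (hX j)

lemma integral_mul_prod_walk (hX : ∀ i t, AEMeasurable (X i t) P)
    (hindep : iIndepFun (fun it : Fin d × Fin n => X it.1 it.2) P)
    {f g : ℝ → ℝ} (hf : Measurable f) (hg : Measurable g)
    {I : Finset (Fin d)} {i : Fin d} (hi : i ∉ I) :
    ∫ ω, g (walk (X i) ω) * ∏ j ∈ I, f (walk (X j) ω) ∂P =
      (∫ ω, g (walk (X i) ω) ∂P) * ∫ ω, ∏ j ∈ I, f (walk (X j) ω) ∂P := by
  have h := (indepFun_walk_of_notMem hX hindep hi).integral_fun_comp_mul_comp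
    (aemeasurable_walk (hX i)) (aemeasurable_walks hX I) (f := g)
    (g := fun x => ∏ j, f (x j)) hg.aestronglyMeasurable
    (Finset.measurable_fun_prod _ fun j _ => hf.comp (measurable_pi_apply j)).aestronglyMeasurable
  have e : ∀ ω, ∏ j : I, f (walk (X j) ω) = ∏ j ∈ I, f (walk (X j) ω) := fun ω =>
    Finset.prod_coe_sort I fun j => f (walk (X j) ω)
  simpa only [e] using h

lemma integral_prod_walk [IsProbabilityMeasure P] (hX : ∀ i t, AEMeasurable (X i t) P)
    (hindep : iIndepFun (fun it : Fin d × Fin n => X it.1 it.2) P)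
    {f : ℝ → ℝ} (hf : Measurable f) (I : Finset (Fin d)) :
    ∫ ω, ∏ j ∈ I, f (walk (X j) ω) ∂P = ∏ j ∈ I, ∫ ω, f (walk (X j) ω) ∂P := by
  induction I using Finset.induction_on with
  | empty => simp
  | insert i I hi ih =>
    simp only [Finset.prod_insert hi]
    rw [integral_mul_prod_walk hX hindep hf hf hi, ih]

lemma integrable_iSup_walk (h : ∀ i, Integrable (walk (X i)) P) (hd : 0 < d) :
    Integrable (fun ω => ⨆ i : Fin d, walk (X i) ω) P := by
  have : Nonempty (Fin d) := ⟨⟨0, hd⟩⟩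
  refine Integrable.mono' (integrable_finsetSum Finset.univ fun i _ => (h i).norm)
    (AEMeasurable.iSup fun i => (h i).aemeasurable).aestronglyMeasurable
    (ae_of_all _ fun ω => ?_)
  obtain ⟨i, hi⟩ := exists_eq_ciSup_of_finite (f := fun i : Fin d => walk (X i) ω)
  simp only [← hi]
  exact Finset.single_le_sum (f := fun i => ‖walk (X i) ω‖) (fun j _ => norm_nonneg _)
    (Finset.mem_univ i)

/-- If each walk exceeds `t` with probability at least `q`, the first walk caps the loss on the
event that none of the others does. -/
lemma mul_one_sub_exp_le_integral_iSup_walk [IsProbabilityMeasure P]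
    (hX : ∀ i t, AEMeasurable (X i t) P)
    (hindep : iIndepFun (fun it : Fin d × Fin n => X it.1 it.2) P)
    (hint : ∀ i, Integrable (walk (X i)) P) (hmean : ∀ i, ∫ ω, walk (X i) ω ∂P = 0)
    (hd : 0 < d) {t q : ℝ} (ht : 0 ≤ t)
    (hq : ∀ i, q ≤ ∫ ω, (Set.Ici t).indicator 1 (walk (X i) ω) ∂P) :
    t * (1 - Real.exp (-(q * (d - 1)))) ≤ ∫ ω, (⨆ i : Fin d, walk (X i) ω) ∂P := by
  set i₀ : Fin d := ⟨0, hd⟩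
  set I : Finset (Fin d) := Finset.univ.erase i₀ with hI
  have hi₀ : i₀ ∉ I := Finset.notMem_erase _ _
  set f : ℝ → ℝ := (Set.Iio t).indicator 1 with hf
  have hfm : Measurable f := measurable_one.indicator measurableSet_Iio
  have hf0 : ∀ x, 0 ≤ f x := fun x => Set.indicator_nonneg (fun _ _ => zero_le_one) x
  have hf1 : ∀ x, f x ≤ 1 := fun x => Set.indicator_le_self' (fun _ _ => zero_le_one) x
  have hfi : ∀ i, ∫ ω, f (walk (X i) ω) ∂P ≤ Real.exp (-q) := fun i => by
    have hgm : Measurable ((Set.Ici t).indicator (1 : ℝ → ℝ)) :=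
      measurable_one.indicator measurableSet_Ici
    have hgi : Integrable (fun ω => (Set.Ici t).indicator (1 : ℝ → ℝ) (walk (X i) ω)) P := by
      refine Integrable.of_bound (C := 1)
        (hgm.comp_aemeasurable (aemeasurable_walk (hX i))).aestronglyMeasurable
        (ae_of_all _ fun ω => ?_)
      by_cases h : t ≤ walk (X i) ω <;> simp [h]
    have e : ∀ ω, f (walk (X i) ω) = 1 - (Set.Ici t).indicator 1 (walk (X i) ω) := fun ω => by
      by_cases h : t ≤ walk (X i) ω
      · simp [hf, h]
      · simp [hf, h, not_le.1 h]
    simp only [e]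
    rw [integral_sub (integrable_const _) hgi]
    simp only [integral_const, probReal_univ, smul_eq_mul, one_mul]
    linarith [hq i, Real.add_one_le_exp (-q)]
  set G : Ω → ℝ := fun ω => ∏ j ∈ I, f (walk (X j) ω) with hG
  have hGm : AEMeasurable G P := Finset.aemeasurable_fun_prod _ fun j _ =>
    hfm.comp_aemeasurable (aemeasurable_walk (hX j))
  have hG0 : ∀ ω, 0 ≤ G ω := fun ω => Finset.prod_nonneg fun j _ => hf0 _
  have hG1 : ∀ ω, G ω ≤ 1 := fun ω => Finset.prod_le_one (fun j _ => hf0 _) fun j _ => hf1 _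
  have hGb : ∀ᵐ ω ∂P, ‖G ω‖ ≤ 1 := ae_of_all _ fun ω => by
    rw [Real.norm_eq_abs, abs_of_nonneg (hG0 ω)]; exact hG1 ω
  have hGi : Integrable G P := Integrable.of_bound hGm.aestronglyMeasurable 1 hGb
  have hWG : Integrable (fun ω => walk (X i₀) ω * G ω) P :=
    (hint i₀).mul_bdd hGm.aestronglyMeasurable hGb
  have hEG : ∫ ω, G ω ∂P ≤ Real.exp (-(q * (d - 1))) := by
    rw [hG, integral_prod_walk hX hindep hfm]
    calc ∏ j ∈ I, ∫ ω, f (walk (X j) ω) ∂P ≤ ∏ _j ∈ I, Real.exp (-q) :=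
          Finset.prod_le_prod (fun j _ => integral_nonneg fun ω => hf0 _) fun j _ => hfi j
      _ = Real.exp (-(q * (d - 1))) := by
          rw [Finset.prod_const, ← Real.exp_nat_mul, hI,
            Finset.card_erase_of_mem (Finset.mem_univ _), Finset.card_univ, Fintype.card_fin,
            Nat.cast_sub hd]
          congr 1; push_cast; ring
  have hEWG : ∫ ω, walk (X i₀) ω * G ω ∂P = 0 := by
    have h := integral_mul_prod_walk hX hindep hfm measurable_id hi₀
    simp only [id_eq, hmean, zero_mul] at h
    exact h
  -- `G` is the indicator that no walk other than `i₀` reaches `t`.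
  have key : ∀ ω, t - t * G ω + walk (X i₀) ω * G ω ≤ ⨆ i : Fin d, walk (X i) ω := fun ω => by
    have hle : ∀ i, walk (X i) ω ≤ ⨆ i : Fin d, walk (X i) ω := fun i =>
      le_ciSup (Set.finite_range fun i : Fin d => walk (X i) ω).bddAbove i
    by_cases h : ∀ j ∈ I, walk (X j) ω < t
    · have : G ω = 1 := Finset.prod_eq_one fun j hj => by simp [hf, h j hj]
      rw [this]; linarith [hle i₀]
    · push Not at h
      obtain ⟨j, hj, hjt⟩ := h
      have : G ω = 0 := Finset.prod_eq_zero hj (by simp [hf, hjt])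
      rw [this]; linarith [hle j]
  have hdiff : Integrable (fun ω => t - t * G ω) P :=
    (integrable_const t).sub (hGi.const_mul t)
  have hmono := integral_mono (hdiff.add hWG) (integrable_iSup_walk hint hd) key
  simp only [Pi.add_apply] at hmono
  rw [integral_add hdiff hWG,
    integral_sub (integrable_const t) (hGi.const_mul t), integral_const_mul, hEWG] at hmono
  simp only [integral_const, probReal_univ, smul_eq_mul, one_mul] at hmono
  nlinarith

end Family

/-! ### Numerical estimates and conclusion -/

lemma log_ge_of_hundred_le {x : ℝ} (hx : 100 ≤ x) : 4.5 ≤ Real.log x := by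
  have h : (9 : ℝ) ≤ Real.log (x ^ 2) := by
    rw [Real.le_log_iff_exp_le (by positivity), show (9 : ℝ) = (9 : ℕ) * 1 by norm_num,
      Real.exp_nat_mul]
    calc Real.exp 1 ^ 9 ≤ 2.7182818286 ^ 9 :=
          pow_le_pow_left₀ (Real.exp_pos 1).le Real.exp_one_lt_d9.le 9
      _ ≤ 100 ^ 2 := by norm_num
      _ ≤ x ^ 2 := by gcongr
  rw [Real.log_pow] at h
  push_cast at h
  linarith

/-- This is `q (d - 1) ≥ 1`: the product is about `x ^ 0.4 / 4`, and `x ^ 0.4` exceeds 4.4 by the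
quadratic bound for `exp` at 1.8. -/
lemma one_le_exp_neg_log_mul {x : ℝ} (hx : 100 ≤ x) :
    1 ≤ Real.exp (-0.6 * Real.log x) / 4 * (x - 1) := by
  have hL := log_ge_of_hundred_le hx
  have h1 : Real.exp (-0.6 * Real.log x) * x = Real.exp (0.4 * Real.log x) := by
    nth_rw 2 [← Real.exp_log (by linarith : 0 < x)]
    rw [← Real.exp_add]; congr 1; ring
  have h2 := Real.quadratic_le_exp_of_nonneg (x := 0.4 * Real.log x) (by linarith)
  nlinarith [Real.exp_pos (-0.6 * Real.log x)]

theorem theoremG1 {Ω : Type*} [MeasurableSpace Ω] (P : Measure Ω) [IsProbabilityMeasure P]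
    (n d : ℕ) (p : ℝ) (hp : 1 / 2 ≤ p) (hp1 : p < 1)
    (hn : 200 * (p / (1 - p)) * Real.log (d : ℝ) ≤ (n : ℝ)) (hd : 100 ≤ d)
    (X : Fin d → Fin n → Ω → ℝ)
    (hlaw : ∀ i t, HasLaw (X i t) (stepLaw p) P)
    (hindep : iIndepFun (fun it : Fin d × Fin n => X it.1 it.2) P) :
    p ≤ 1 - 1 / (n : ℝ) ∧
    Integrable (fun ω => ⨆ i : Fin d, walk (X i) ω) P ∧
    0.02 * √((n : ℝ) * p * (1 - p) * Real.log (d : ℝ)) - 1.5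
      ≤ ∫ ω, (⨆ i : Fin d, walk (X i) ω) ∂P := by
  have hp0 : 0 < p := by linarith
  have hq : 0 < 1 - p := by linarith
  have hdR : (100 : ℝ) ≤ d := by exact_mod_cast hd
  have hL := log_ge_of_hundred_le hdR
  have hint : ∀ i, Integrable (walk (X i)) P := fun i => integrable_walk (hlaw i) hp0.le hp1.le
  refine ⟨?_, integrable_iSup_walk hint (by omega), ?_⟩
  · have h1 : 1 / (1 - p) ≤ n := by
      refine le_trans ?_ hn
      rw [show 200 * (p / (1 - p)) * Real.log d = 200 * p * Real.log d / (1 - p) by ring]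
      refine div_le_div_of_nonneg_right ?_ hq.le
      nlinarith
    have h2 : 1 / (n : ℝ) ≤ 1 - p :=
      (one_div_le hq (lt_of_lt_of_le (by positivity) h1)).1 h1
    linarith
  · set t : ℝ := 0.06 * √((n : ℝ) * p * (1 - p) * Real.log (d : ℝ)) with ht
    have ht0 : 0 ≤ t := by positivity
    have h := mul_one_sub_exp_le_integral_iSup_walk (fun i t => (hlaw i t).aemeasurable) hindep
      hint (fun i => integral_walk (hlaw i) hp0.le hp1.le) (by omega) ht0 fun i =>
      div_le_integral_indicator_walk (hlaw i) (iIndepFun_row hindep i) hp hp1 hL hn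
    have h1 : Real.exp (-(Real.exp (-0.6 * Real.log d) / 4 * ((d : ℝ) - 1))) ≤ 1 / 2 := by
      have h2 := one_le_exp_neg_log_mul hdR
      have h3 := Real.add_one_le_exp (1 : ℝ)
      rw [Real.exp_neg, one_div]
      refine inv_anti₀ (by norm_num) (le_trans ?_ (Real.exp_le_exp.2 h2))
      linarith
    -- The bound obtained is `t / 2 = 0.03 √(v L)`, stronger than required.
    nlinarith
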